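/- Let $M$ be a finite matroid with rank function $r$. For a rooted tree $T$ (a finite tree with a distinguished vertex, its root), let $\|T\|$ be the number of edges of $T$; a leaf of $T$ is a vertex without children (so the root is a leaf exactly when $T$ has a single vertex), and the depth of $T$ is the length, in edges, of a longest path from the root to a leaf. A depth-decomposition of $M$ is a pair $(T,f)$, where $T$ is a rooted tree and $f$ is a map from the set of elements of $M$ to the vertex set $V(T)$, such that $r(M)=\|T\|$ and $r(X)\le\|T^*(X)\|$ for every set $X$ of elements of $M$, where $T^*(X)$ is the union of the paths in $T$ from the root to all the vertices in $f(X)$. The branch-depth $\mathrm{bd}(M)$ of $M$ is the smallest depth of a tree $T$ over all depth-decompositions $(T,f)$ of $M$. Then there are a depth-decomposition $(T,f)$ of $M$ and a base $B$ of $M$ such that the restriction of $f$ to $B$ is a bijection between $B$ and the set of non-root vertices of $T$, $f(e)$ is a leaf of $T$ for every element $e\notin B$ of $M$, and the depth of $T$ is at most $4^{\mathrm{bd}(M)}$. -/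

import Mathlib

/-- A finite rooted tree: a finite tree (as a graph) with a distinguished vertex, the root. -/
structure FinRootedTree where
  /-- The vertices of the tree. -/
  V : Type
  finite : Finite V
  /-- The underlying graph. -/
  graph : SimpleGraph V
  isTree : graph.IsTree
  /-- The root. -/
  root : V

namespace FinRootedTree

/-- `u` is a child of `v`: they are adjacent and `u` is one step farther from the root. -/
def IsChild (T : FinRootedTree) (u v : T.V) : Prop :=
  T.graph.Adj v u ∧ T.graph.dist T.root u = T.graph.dist T.root v + 1

/-- A leaf of a rooted tree is a vertex without children. In particular the root is a leaf
exactly if the tree has a single vertex. -/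
def IsLeaf (T : FinRootedTree) (v : T.V) : Prop :=
  ∀ u, ¬ T.IsChild u v

/-- The depth of a rooted tree: the length of a longest path from the root to a leaf. -/
noncomputable def depth (T : FinRootedTree) : ℕ :=
  sSup {n | ∃ v, T.IsLeaf v ∧ ∃ p : T.graph.Walk T.root v, p.IsPath ∧ p.length = n}

/-- The edges of the union of the paths from the root to all the vertices in `S`. -/
def rootPathsEdges (T : FinRootedTree) (S : Set T.V) : Set (Sym2 T.V) :=
  {a | ∃ v ∈ S, ∃ p : T.graph.Walk T.root v, p.IsPath ∧ a ∈ p.edges}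

end FinRootedTree

/-- A depth-decomposition of a matroid `M`. Only the values of `f` on the ground set `M.E`
matter. -/
structure DepthDecomposition {α : Type*} (M : Matroid α) where
  /-- The tree of the decomposition. -/
  tree : FinRootedTree
  /-- The map from the elements of `M` to the vertices of the tree. -/
  f : α → tree.V
  rank_eq : M.eRank = tree.graph.edgeSet.encard
  rank_le : ∀ X ⊆ M.E, M.eRk X ≤ (tree.rootPathsEdges (f '' X)).encard

/-- The branch-depth of `M`: the smallest depth of the tree of a depth-decomposition of `M`. -/
noncomputable def branchDepth {α : Type*} (M : Matroid α) : ℕ :=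
  sInf {d | ∃ D : DepthDecomposition M, D.tree.depth = d}

/-! Circuit length links the two sides. A depth-decomposition of depth `d` forces every circuit to
have at most `2 ^ d` elements (`ncard_isCircuit_le`). Conversely, if circuits have at most `c`
elements, a decomposition of the required shape and of depth at most `c ^ 2` exists
(`exists_isBaseWords_of_forall_isCircuit_ncard_le`). Take `c` to be 2 to the branch-depth.

For the first bound, let `C` be the circuit in `B + x` for a base `B`, and call the number of
elements of a set minus the number of edges on their root paths its excess. It is at most 0 on sets
not containing `C`, and equals 1 on `B + x`. Sorting elements by the first edge of their root paths
and deleting that edge at most doubles the excess of each relevant group, once per level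
(`card_le_two_pow_mul_of_trieExcess`).

For the converse, trees of the two sides of a separation are glued at the root. In a nonseparable
matroid, contracting all but one element of a longest circuit leaves only shorter circuits
(`ncard_lt_of_contract`). The contracted elements become a path at the root, and `(c - 1) ^ 2 + (c -
1) ≤ c ^ 2`. -/

namespace Matroid

/-! ### Longest circuits in nonseparable matroids -/

variable {α : Type*} {M : Matroid α} {C D Z Z' : Set α} {e : α}

/-- A matroid is nonseparable if every proper nonempty part of its ground set is crossed by a
circuit. -/
def IsNonseparable (M : Matroid α) : Prop :=
  ∀ K ⊆ M.E, K.Nonempty → K ≠ M.E → ∃ C, M.IsCircuit C ∧ (C ∩ K).Nonempty ∧ (C \ K).Nonempty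

lemma IsCircuit.subset_of_subset (hZ : M.IsCircuit Z) (hZ' : M.IsCircuit Z') (h : Z' ⊆ Z) :
    Z ⊆ Z' :=
  (hZ.eq_of_superset_isCircuit hZ' h).subset

/-- Transitivity of lying in a common circuit. Two strong eliminations replace `Z` by a circuit that
still meets `C` and `Z'` but has fewer elements outside `Z'`. -/
lemma IsCircuit.exists_isCircuit_inter_nonempty_mem [M.Finite] (hZ' : M.IsCircuit Z')
    (he : e ∈ Z') (hZ : M.IsCircuit Z) (hZC : (Z ∩ C).Nonempty) (hZZ' : (Z ∩ Z').Nonempty) :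
    ∃ W, M.IsCircuit W ∧ (W ∩ C).Nonempty ∧ e ∈ W := by
  induction hn : (Z \ Z').ncard using Nat.strong_induction_on generalizing Z with
  | _ n ih =>
  by_contra! hcon
  have heZ : e ∉ Z := hcon Z hZ hZC
  obtain ⟨a, haZ, haZ'⟩ := hZZ'
  obtain ⟨W, hWss, hW, heW⟩ := hZ'.strong_elimination hZ haZ' haZ he heZ
  have hWC : ∀ c ∈ C, c ∉ W := fun c hc hcW ↦ hcon W hW ⟨c, hcW, hc⟩ heW
  have haW : a ∉ W := fun h ↦ (hWss h).2 rfl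
  obtain ⟨b, hbW, hbZ'⟩ : ∃ b ∈ W, b ∉ Z' := by
    by_contra! h
    exact haW (hZ'.subset_of_subset hW h haZ')
  have hbZ : b ∈ Z := (hWss hbW).1.resolve_left hbZ'
  obtain ⟨x, hxZ, hxC⟩ := hZC
  obtain ⟨U, hUss, hU, hxU⟩ := hZ.strong_elimination hW hbZ hbW hxZ (hWC x hxC)
  have hbU : b ∉ U := fun h ↦ (hUss h).2 rfl
  obtain ⟨y, hyU, hyZ⟩ : ∃ y ∈ U, y ∉ Z := by
    by_contra! h
    exact hbU (hZ.subset_of_subset hU h hbZ)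
  have hyZ' : y ∈ Z' := (hWss ((hUss hyU).1.resolve_left hyZ)).1.resolve_right hyZ
  have hlt : (U \ Z').ncard < n := by
    rw [← hn]
    refine Set.ncard_lt_ncard ?_ (hZ.finite.subset Set.sdiff_subset)
    refine ⟨fun u hu ↦ ⟨?_, hu.2⟩, fun h ↦ hbU (h ⟨hbZ, hbZ'⟩).1⟩
    obtain h | h := (hUss hu.1).1
    · exact h
    · exact (hWss h).1.resolve_left hu.2
  obtain ⟨V, hV, hVC, heV⟩ := ih _ hlt hU ⟨x, hxU, hxC⟩ ⟨y, hyU, hyZ'⟩ rfl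
  exact hcon V hV hVC heV

lemma IsNonseparable.exists_isCircuit_inter_nonempty_mem [M.Finite] (hM : M.IsNonseparable)
    (hC : M.IsCircuit C) (he : e ∈ M.E) :
    ∃ Z, M.IsCircuit Z ∧ (Z ∩ C).Nonempty ∧ e ∈ Z := by
  by_contra heA
  set A : Set α := {a | ∃ Z, M.IsCircuit Z ∧ (Z ∩ C).Nonempty ∧ a ∈ Z} with hA
  have hAE : A ⊆ M.E := by
    rintro a ⟨Z, hZ, -, haZ⟩
    exact hZ.subset_ground haZ
  obtain ⟨c, hc⟩ := hC.nonempty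
  obtain ⟨Z', hZ', ⟨a, haZ', Z, hZ, hZC, haZ⟩, ⟨b, hbZ', hbA⟩⟩ := hM A hAE
    ⟨c, C, hC, by simpa using ⟨c, hc⟩, hc⟩ (fun h ↦ heA (h ▸ he : e ∈ A))
  exact hbA (hZ'.exists_isCircuit_inter_nonempty_mem hbZ' hZ hZC ⟨a, haZ, haZ'⟩)

/-- If `Z` is a circuit meeting the disjoint circuits `C` and `D` with as few elements outside
`C ∪ D` as possible, then the part of `Z` in `C` can be swapped for its complement in `C`. -/
lemma IsCircuit.exists_swap (hC : M.IsCircuit C) (hZ : M.IsCircuit Z)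
    (hdj : Disjoint C D) (hZC : (Z ∩ C).Nonempty) (hZD : (Z ∩ D).Nonempty)
    (hO : (Z \ (C ∪ D)).Nonempty)
    (hmin : ∀ W, M.IsCircuit W → (W ∩ C).Nonempty → (W ∩ D).Nonempty →
      W \ (C ∪ D) ⊆ Z \ (C ∪ D) → Z \ (C ∪ D) ⊆ W) :
    ∃ W, M.IsCircuit W ∧ W ∩ D = Z ∩ D ∧ C \ Z ⊆ W ∧ W \ (C ∪ D) = Z \ (C ∪ D) := by
  obtain ⟨p, hpZ, hpC⟩ := hZC
  obtain ⟨q, hqZ, hqD⟩ := hZD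
  obtain ⟨o, hoZ, hoCD⟩ := hO
  have hCD : ∀ x ∈ C, x ∉ D := fun x hx hx' ↦ hdj.notMem_of_mem_left hx hx'
  obtain ⟨W, hWss, hW, hqW⟩ := hZ.strong_elimination hC hpZ hpC hqZ (fun h ↦ hCD q h hqD)
  have hWZ : ∀ x ∈ W, x ∉ C → x ∈ Z := fun x hx hxC ↦ (hWss hx).1.resolve_right hxC
  have hpW : p ∉ W := fun h ↦ (hWss h).2 rfl
  -- a circuit inside `C ∪ Z` that meets `D` contains everything of `Z` outside `C ∪ D`
  have key : ∀ U, M.IsCircuit U → U ⊆ C ∪ Z → (U ∩ D).Nonempty → ∀ o' ∈ Z \ (C ∪ D), o' ∈ U := by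
    intro U hU hUss hUD o' ho'
    by_cases hUC : (U ∩ C).Nonempty
    · exact hmin U hU hUC hUD (fun x hx ↦ ⟨(hUss hx.1).resolve_left fun h ↦ hx.2 (.inl h), hx.2⟩) ho'
    · exact hZ.subset_of_subset hU
        (fun x hx ↦ (hUss hx).resolve_left fun h ↦ hUC ⟨x, hx, h⟩) ho'.1
  have hWCZ : W ⊆ C ∪ Z := fun x hx ↦ (hWss hx).1.symm
  have hOW := key W hW hWCZ ⟨q, hqW, hqD⟩
  refine ⟨W, hW, ?_, ?_, ?_⟩
  · refine Set.Subset.antisymm (fun x hx ↦ ⟨hWZ x hx.1 fun h ↦ hCD x h hx.2, hx.2⟩)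
      (fun x hx ↦ ⟨?_, hx.2⟩)
    by_contra hxW
    obtain ⟨U, hUss, hU, hxU⟩ := hZ.strong_elimination hW hoZ (hOW o ⟨hoZ, hoCD⟩) hx.1 hxW
    have hoU := key U hU (fun y hy ↦ (hUss hy).1.elim .inr (fun h ↦ hWCZ h)) ⟨x, hxU, hx.2⟩
      o ⟨hoZ, hoCD⟩
    exact (hUss hoU).2 rfl
  -- Since `U` misses `o`, `key` keeps it away from `D`. A further elimination shows `U ⊆ C`, hence
  -- `U = C`, so `C` is covered by `Z` and `W`.
  · obtain ⟨U, hUss, hU⟩ := hZ.elimination hW (fun h ↦ hpW (h ▸ hpZ)) o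
    have hUCZ : U ⊆ C ∪ Z := fun y hy ↦ (hUss hy).1.elim .inr (fun h ↦ hWCZ h)
    have hUD : ∀ x ∈ U, x ∉ D := fun x hx hxD ↦
      (hUss (key U hU hUCZ ⟨x, hx, hxD⟩ o ⟨hoZ, hoCD⟩)).2 rfl
    have hUC : U ⊆ C := by
      intro y hy
      by_contra hyC
      have hyZ : y ∈ Z := (hUCZ hy).resolve_left hyC
      obtain ⟨V, hVss, hV, hqV⟩ := hZ.strong_elimination hU hyZ hy hqZ (fun h ↦ hUD q h hqD)
      have hyV := key V hV (fun z hz ↦ (hVss hz).1.elim .inr (fun h ↦ hUCZ h)) ⟨q, hqV, hqD⟩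
        y ⟨hyZ, fun h ↦ h.elim hyC (hUD y hy)⟩
      exact (hVss hyV).2 rfl
    have hCU := hC.subset_of_subset hU hUC
    exact fun x hx ↦ (hUss (hCU hx.1)).1.resolve_left hx.2
  · exact Set.Subset.antisymm
      (fun x hx ↦ ⟨hWZ x hx.1 fun h ↦ hx.2 (.inl h), hx.2⟩) (fun x hx ↦ ⟨hOW x hx, hx.2⟩)

/-- One of `C ∩ Z` and `C \ Z` has at least half of the elements of `C`; swap if it is the latter.
-/
lemma IsCircuit.exists_swap_large [M.Finite] (hC : M.IsCircuit C) (hZ : M.IsCircuit Z)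
    (hdj : Disjoint C D) (hZC : (Z ∩ C).Nonempty) (hZD : (Z ∩ D).Nonempty)
    (hO : (Z \ (C ∪ D)).Nonempty)
    (hmin : ∀ W, M.IsCircuit W → (W ∩ C).Nonempty → (W ∩ D).Nonempty →
      W \ (C ∪ D) ⊆ Z \ (C ∪ D) → Z \ (C ∪ D) ⊆ W) :
    ∃ W, M.IsCircuit W ∧ W ∩ D = Z ∩ D ∧ W \ (C ∪ D) = Z \ (C ∪ D) ∧
      C.ncard ≤ 2 * (W ∩ C).ncard := by
  have hcard := Set.ncard_inter_add_ncard_sdiff_eq_ncard C Z hC.finite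
  rw [Set.inter_comm] at hcard
  by_cases hle : C.ncard ≤ 2 * (Z ∩ C).ncard
  · exact ⟨Z, hZ, rfl, rfl, hle⟩
  obtain ⟨W, hW, hWD, hCW, hWO⟩ := hC.exists_swap hZ hdj hZC hZD hO hmin
  refine ⟨W, hW, hWD, hWO, ?_⟩
  have hss : C \ Z ⊆ W ∩ C := fun x hx ↦ ⟨hCW hx, hx.1⟩
  have := Set.ncard_le_ncard hss (hC.finite.subset Set.inter_subset_right)
  omega

/-- In a nonseparable matroid, a circuit `D` disjoint from a longest circuit `C` is shorter than
`C`, provided that no circuit inside `C ∪ D` meets both. -/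
lemma IsNonseparable.ncard_lt_of_disjoint [M.Finite] (hM : M.IsNonseparable)
    (hC : M.IsCircuit C) (hmax : ∀ Z, M.IsCircuit Z → Z.ncard ≤ C.ncard)
    (hD : M.IsCircuit D) (hdj : Disjoint C D)
    (hskew : ∀ Z, M.IsCircuit Z → (Z ∩ C).Nonempty → (Z ∩ D).Nonempty →
      (Z \ (C ∪ D)).Nonempty) :
    D.ncard < C.ncard := by
  obtain ⟨d, hd⟩ := hD.nonempty
  obtain ⟨Z₀, hZ₀, hZ₀C, hdZ₀⟩ := hM.exists_isCircuit_inter_nonempty_mem hC (hD.subset_ground hd)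
  let F : Set (Set α) := {Z | M.IsCircuit Z ∧ (Z ∩ C).Nonempty ∧ (Z ∩ D).Nonempty}
  obtain ⟨Z, ⟨hZ, hZC, hZD⟩, hZmin⟩ := exists_minimalFor_of_wellFoundedLT (· ∈ F)
    (fun Z ↦ (Z \ (C ∪ D)).ncard) ⟨Z₀, hZ₀, hZ₀C, d, hdZ₀, hd⟩
  have hfin : ∀ Z, M.IsCircuit Z → (Z \ (C ∪ D)).Finite := fun Z hZ ↦
    hZ.finite.subset Set.sdiff_subset
  have hmin : ∀ W, M.IsCircuit W → (W ∩ C).Nonempty → (W ∩ D).Nonempty →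
      W \ (C ∪ D) ⊆ Z \ (C ∪ D) → Z \ (C ∪ D) ⊆ W := by
    intro W hW hWC hWD hss
    have hle := hZmin ⟨hW, hWC, hWD⟩ (Set.ncard_le_ncard hss (hfin Z hZ))
    rw [← Set.eq_of_subset_of_ncard_le hss hle (hfin Z hZ)]
    exact Set.sdiff_subset
  obtain ⟨W, hW, hWD, hWO, hWC⟩ := hC.exists_swap_large hZ hdj hZC hZD (hskew Z hZ hZC hZD) hmin
  have hWC' : (W ∩ C).Nonempty := by
    rw [← Set.ncard_pos (hW.finite.subset Set.inter_subset_left)]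
    have := (Set.ncard_pos hC.finite).2 hC.nonempty
    omega
  have hWD' : (W ∩ D).Nonempty := hWD ▸ hZD
  -- The first swap kept the part outside `C ∪ D`, so minimality still applies with `C` and `D`
  -- exchanged. The result `V` has half of `C`, half of `D` and at least one element more, yet at
  -- most `|C|` elements.
  obtain ⟨V, hV, hVC, hVO, hVD⟩ := hD.exists_swap_large hW hdj.symm hWD' hWC'
    (by rw [Set.union_comm]; exact hskew W hW hWC' hWD')
    (by
      rw [Set.union_comm, hWO]
      exact fun U hU hUD hUC hss ↦ hmin U hU hUC hUD hss)
  rw [Set.union_comm] at hVO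
  have h1 := Set.ncard_inter_add_ncard_sdiff_eq_ncard V (C ∪ D) hV.finite
  have h2 : (V ∩ (C ∪ D)).ncard = (V ∩ C).ncard + (V ∩ D).ncard := by
    rw [Set.inter_union_distrib_left, Set.ncard_union_eq
      (hdj.mono Set.inter_subset_right Set.inter_subset_right)
      (hV.finite.subset Set.inter_subset_left) (hV.finite.subset Set.inter_subset_left)]
  have h3 : 0 < (V \ (C ∪ D)).ncard := by
    rw [Set.ncard_pos (hfin V hV), hVO]
    exact hskew W hW hWC' hWD'
  have := hmax V hV
  rw [hVC] at h2
  omega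

/-- Contracting all but one element of a longest circuit of a nonseparable matroid makes all
circuits shorter. -/
lemma IsNonseparable.ncard_lt_of_contract [M.Finite] (hM : M.IsNonseparable)
    (hC : M.IsCircuit C) (hmax : ∀ Z, M.IsCircuit Z → Z.ncard ≤ C.ncard) (hC1 : 1 < C.ncard)
    (he : e ∈ C) (hD : (M ／ (C \ {e})).IsCircuit D) : D.ncard < C.ncard := by
  have hI := hC.sdiff_singleton_indep he
  obtain ⟨Z, hZ, hDZ, hZss⟩ := hD.exists_subset_isCircuit_of_contract
  have hDI : Disjoint D (C \ {e}) := (hI.contract_dep_iff.1 hD.dep).1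
  -- If `D` is a proper part of `Z`, maximality of `C` suffices. Otherwise `D` is a circuit of `M`:
  -- either it is the loop `{e}` of the contraction, or it is disjoint from `C` and
  -- `ncard_lt_of_disjoint` applies.
  by_cases hne : Z = D
  · subst hne
    by_cases heD : e ∈ Z
    · have hdep : (M ／ (C \ {e})).Dep {e} := by
        rw [hI.contract_dep_iff, Set.singleton_union, Set.insert_sdiff_singleton,
          Set.insert_eq_of_mem he]
        exact ⟨by simp, hC.dep⟩
      rw [← hD.eq_of_dep_subset hdep (by simpa using heD)]
      simpa using hC1
    refine hM.ncard_lt_of_disjoint hC hmax hZ ?_ fun W hW hWC hWD ↦ ?_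
    · refine Set.disjoint_left.2 fun x hxC hxZ ↦ ?_
      exact Set.disjoint_left.1 hDI hxZ ⟨hxC, fun h ↦ heD (h ▸ hxZ)⟩
    · by_contra! hWO
      have hWss : W ⊆ C ∪ Z := by rwa [← Set.sdiff_eq_empty]
      have hdep : (M ／ (C \ {e})).Dep (W \ C) := by
        rw [dep_iff, hI.contract_indep_iff]
        refine ⟨fun h ↦ ?_, ?_⟩
        · obtain ⟨z, hzW, hzZ⟩ := hWD
          have hzC : z ∉ C := fun hzC ↦
            Set.disjoint_left.1 hDI hzZ ⟨hzC, fun h ↦ heD (h ▸ hzZ)⟩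
          obtain ⟨U, hUss, hU⟩ : ∃ U ⊆ (W ∪ C) \ {e}, M.IsCircuit U :=
            hW.elimination hC (fun h ↦ hzC (h ▸ hzW)) e
          refine hU.not_indep (h.2.subset fun x hx ↦ ?_)
          obtain ⟨h1, h2⟩ := hUss hx
          by_cases hxC : x ∈ C
          · exact .inr ⟨hxC, h2⟩
          · exact .inl ⟨h1.resolve_right hxC, hxC⟩
        · exact fun x hx ↦ ⟨hW.subset_ground hx.1, fun h ↦ hx.2 h.1⟩
      have hWZ := hD.eq_of_dep_subset hdep fun x hx ↦ (hWss hx.1).resolve_left hx.2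
      have hZW : Z ⊆ W := hWZ ▸ Set.sdiff_subset
      obtain ⟨x, hxW, hxC⟩ := hWC
      have := hW.subset_of_subset hZ hZW hxW
      rw [← hWZ] at this
      exact this.2 hxC
  · exact (Set.ncard_lt_ncard (hDZ.ssubset_of_ne (Ne.symm hne)) hZ.finite).trans_le (hmax Z hZ)

end Matroid

/-! ### Building the tree, encoded by words, from a bound on circuit length -/

namespace Matroid

variable {α : Type*} {M : Matroid α} {B I X K : Set α} {p : α → List α} {c d : ℕ} {e : α}

/-- A base `B` together with words `p` over `B` which describe a rooted tree with vertex set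
`B ∪ {root}`: the word of `b ∈ B` lists the vertices on the path from the root to `b`, and
the word of any other element is the word of a vertex. The words satisfy the rank condition of a
depth-decomposition and have length at most `d`. -/
structure IsBaseWords (M : Matroid α) (B : Set α) (p : α → List α) (d : ℕ) : Prop where
  isBase : M.IsBase B
  parent : ∀ b ∈ B, ∃ q, p b = q ++ [b] ∧ (q = [] ∨ ∃ b' ∈ B, p b' = q)
  vertex : ∀ e ∈ M.E, p e = [] ∨ ∃ b ∈ B, p b = p e
  letters : ∀ e ∈ M.E, ∀ x ∈ p e, x ∈ B
  length_le : ∀ e ∈ M.E, (p e).length ≤ d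
  eRk_le : ∀ X ⊆ M.E, M.eRk X ≤ {x | ∃ e ∈ X, x ∈ p e}.encard

lemma IsBaseWords.mono {d' : ℕ} (h : M.IsBaseWords B p d) (hd : d ≤ d') : M.IsBaseWords B p d' :=
  { h with length_le := fun e he ↦ (h.length_le e he).trans hd }

lemma exists_isBaseWords_of_subsingleton (hE : M.E.Subsingleton) :
    ∃ B p, M.IsBaseWords B p 1 := by
  classical
  obtain ⟨B, hB⟩ := M.exists_isBase
  refine ⟨B, fun e ↦ if e ∈ B then [e] else [], hB, ?_, ?_, ?_, ?_, ?_⟩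
  · exact fun b hb ↦ ⟨[], by simp [hb], .inl rfl⟩
  · intro e he
    by_cases h : e ∈ B
    · exact .inr ⟨e, h, rfl⟩
    · simp [h]
  · intro e he x hx
    by_cases h : e ∈ B
    · simp only [h, if_true, List.mem_singleton] at hx
      exact hx ▸ h
    · simp [h] at hx
  · intro e he
    split_ifs <;> simp
  · intro X hX
    obtain rfl | ⟨x, hx⟩ := X.eq_empty_or_nonempty
    · simp
    refine (M.eRk_le_eRank X).trans (hB.encard_eq_eRank ▸ Set.encard_le_encard fun b hb ↦ ?_)
    have hbx : b = x := hE (hB.subset_ground hb) (hX hx)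
    exact ⟨b, hbx ▸ hx, by simp [hb]⟩

/-- The two trees are glued at their roots. Their letters are disjoint, so the covered edges add up,
while rank is subadditive. -/
lemma exists_isBaseWords_of_separation (hKE : K ⊆ M.E)
    (hK : ∀ C, M.IsCircuit C → C ⊆ K ∨ C ⊆ M.E \ K)
    (h₁ : ∃ B p, (M ↾ K).IsBaseWords B p d) (h₂ : ∃ B p, (M ↾ (M.E \ K)).IsBaseWords B p d) :
    ∃ B p, M.IsBaseWords B p d := by
  classical
  obtain ⟨B₁, p₁, h₁⟩ := h₁
  obtain ⟨B₂, p₂, h₂⟩ := h₂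
  have hb₁ : M.IsBasis B₁ K := (isBase_restrict_iff hKE).1 h₁.isBase
  have hb₂ : M.IsBasis B₂ (M.E \ K) := (isBase_restrict_iff Set.sdiff_subset).1 h₂.isBase
  have hind : M.Indep (B₁ ∪ B₂) := by
    rw [indep_iff_forall_subset_not_isCircuit
      (Set.union_subset hb₁.indep.subset_ground hb₂.indep.subset_ground)]
    intro C hCss hC
    obtain h | h := hK C hC
    · exact hC.not_indep (hb₁.indep.subset fun x hx ↦
        (hCss hx).resolve_right fun h' ↦ (hb₂.subset h').2 (h hx))
    · exact hC.not_indep (hb₂.indep.subset fun x hx ↦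
        (hCss hx).resolve_left fun h' ↦ (h hx).2 (hb₁.subset h'))
  have hbase : M.IsBase (B₁ ∪ B₂) := by
    have := hb₁.union_isBasis_union hb₂ hind
    rwa [Set.union_sdiff_cancel hKE, isBasis_ground_iff] at this
  set p : α → List α := fun e ↦ if e ∈ K then p₁ e else p₂ e with hp
  have hp₁ : ∀ e ∈ K, p e = p₁ e := fun e he ↦ if_pos he
  have hp₂ : ∀ e ∈ M.E \ K, p e = p₂ e := fun e he ↦ if_neg he.2
  refine ⟨B₁ ∪ B₂, p, hbase, ?_, ?_, ?_, ?_, ?_⟩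
  · rintro b (hb | hb)
    · obtain ⟨q, hq, hq'⟩ := h₁.parent b hb
      refine ⟨q, (hp₁ b (hb₁.subset hb)).trans hq, hq'.imp_right ?_⟩
      rintro ⟨b', hb', h⟩
      exact ⟨b', .inl hb', (hp₁ b' (hb₁.subset hb')).trans h⟩
    · obtain ⟨q, hq, hq'⟩ := h₂.parent b hb
      refine ⟨q, (hp₂ b (hb₂.subset hb)).trans hq, hq'.imp_right ?_⟩
      rintro ⟨b', hb', h⟩
      exact ⟨b', .inr hb', (hp₂ b' (hb₂.subset hb')).trans h⟩
  · intro e he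
    by_cases heK : e ∈ K
    · rw [hp₁ e heK]
      refine (h₁.vertex e heK).imp_right ?_
      rintro ⟨b, hb, h⟩
      exact ⟨b, .inl hb, (hp₁ b (hb₁.subset hb)).trans h⟩
    · rw [hp₂ e ⟨he, heK⟩]
      refine (h₂.vertex e ⟨he, heK⟩).imp_right ?_
      rintro ⟨b, hb, h⟩
      exact ⟨b, .inr hb, (hp₂ b (hb₂.subset hb)).trans h⟩
  · intro e he x hx
    by_cases heK : e ∈ K
    · exact .inl (h₁.letters e heK x (hp₁ e heK ▸ hx))
    · exact .inr (h₂.letters e ⟨he, heK⟩ x (hp₂ e ⟨he, heK⟩ ▸ hx))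
  · intro e he
    by_cases heK : e ∈ K
    · exact hp₁ e heK ▸ h₁.length_le e heK
    · exact hp₂ e ⟨he, heK⟩ ▸ h₂.length_le e ⟨he, heK⟩
  · intro X hX
    have hle₁ := h₁.eRk_le (X ∩ K) Set.inter_subset_right
    have hle₂ := h₂.eRk_le (X \ K) (Set.sdiff_subset_sdiff_left hX)
    rw [restrict_eRk_eq _ Set.inter_subset_right] at hle₁
    rw [restrict_eRk_eq _ (Set.sdiff_subset_sdiff_left hX)] at hle₂
    refine (M.eRk_le_eRk_inter_add_eRk_sdiff X K).trans ((add_le_add hle₁ hle₂).trans ?_)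
    rw [← Set.encard_union_eq]
    · refine Set.encard_le_encard ?_
      rintro x (⟨e, he, hx⟩ | ⟨e, he, hx⟩)
      · exact ⟨e, he.1, hp₁ e he.2 ▸ hx⟩
      · exact ⟨e, he.1, hp₂ e ⟨hX he.1, he.2⟩ ▸ hx⟩
    · rw [Set.disjoint_left]
      rintro x ⟨e, he, hx⟩ ⟨e', he', hx'⟩
      exact (hb₂.subset (h₂.letters e' ⟨hX he'.1, he'.2⟩ x hx')).2
        (hb₁.subset (h₁.letters e he.2 x hx))

lemma IsNonloop.eRk_le_eRk_contractElem_add_one (he : M.IsNonloop e) (hX : X ⊆ M.E) :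
    M.eRk X ≤ (M ／ {e}).eRk (X \ {e}) + 1 := by
  obtain ⟨J, hJ⟩ := (M ／ {e}).exists_isBasis (X \ {e}) (Set.sdiff_subset_sdiff_left hX)
  have hb := he.indep.union_isBasis_union_of_contract_isBasis hJ
  rw [← hJ.encard_eq_eRk]
  calc M.eRk X ≤ M.eRk (X \ {e} ∪ {e}) := M.eRk_mono (by simp)
    _ = (J ∪ {e}).encard := hb.encard_eq_eRk.symm
    _ ≤ J.encard + 1 := by simpa using Set.encard_union_le J {e}

/-- The old root becomes the vertex `e`, hung below a new root: every word gets the first letter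
`e`, which pays for the one unit of rank lost in the contraction. -/
lemma IsNonloop.exists_isBaseWords_of_contractElem (he : M.IsNonloop e)
    (h : ∃ B p, (M ／ {e}).IsBaseWords B p d) : ∃ B p, M.IsBaseWords B p (d + 1) := by
  classical
  obtain ⟨B, p', h⟩ := h
  obtain ⟨hbase, hdj⟩ := he.indep.contract_isBase_iff.1 h.isBase
  have heB : e ∉ B := by simpa using hdj
  set p : α → List α := fun x ↦ if x = e then [e] else e :: p' x with hp
  have hpe : p e = [e] := if_pos rfl
  have hpx : ∀ x, x ≠ e → p x = e :: p' x := fun x hx ↦ if_neg hx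
  have hBne : ∀ b ∈ B, b ≠ e := fun b hb h ↦ heB (h ▸ hb)
  have hEx : ∀ x ∈ M.E, x ≠ e → x ∈ (M ／ {e}).E := fun x hx hne ↦ ⟨hx, hne⟩
  refine ⟨B ∪ {e}, p, hbase, ?_, ?_, ?_, ?_, ?_⟩
  · rintro b (hb | rfl)
    · obtain ⟨q, hq, hq'⟩ := h.parent b hb
      refine ⟨e :: q, by rw [hpx b (hBne b hb), hq, List.cons_append], .inr ?_⟩
      obtain rfl | ⟨b', hb', rfl⟩ := hq'
      · exact ⟨e, .inr rfl, hpe⟩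
      · exact ⟨b', .inl hb', hpx b' (hBne b' hb')⟩
    · exact ⟨[], hpe, .inl rfl⟩
  · intro x hx
    right
    by_cases hxe : x = e
    · exact ⟨e, .inr rfl, by rw [hxe]⟩
    obtain h0 | ⟨b, hb, h0⟩ := h.vertex x (hEx x hx hxe)
    · exact ⟨e, .inr rfl, by rw [hpe, hpx x hxe, h0]⟩
    · exact ⟨b, .inl hb, by rw [hpx b (hBne b hb), hpx x hxe, h0]⟩
  · intro x hx y hy
    by_cases hxe : x = e
    · rw [hxe, hpe, List.mem_singleton] at hy
      exact .inr hy
    rw [hpx x hxe, List.mem_cons] at hy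
    exact hy.symm.imp_left (h.letters x (hEx x hx hxe) y)
  · intro x hx
    by_cases hxe : x = e
    · simp [hxe, hpe]
    · simpa [hpx x hxe] using h.length_le x (hEx x hx hxe)
  · intro X hX
    obtain rfl | ⟨x, hx⟩ := X.eq_empty_or_nonempty
    · simp
    have hss : X \ {e} ⊆ (M ／ {e}).E := Set.sdiff_subset_sdiff_left hX
    refine (he.eRk_le_eRk_contractElem_add_one hX).trans
      ((add_le_add_left (h.eRk_le _ hss) 1).trans ?_)
    rw [← Set.encard_insert_of_notMem (a := e)]
    · refine Set.encard_le_encard (Set.insert_subset ?_ ?_)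
      · refine ⟨x, hx, ?_⟩
        by_cases hxe : x = e
        · simp [hxe, hpe]
        · simp [hpx x hxe]
      · rintro y ⟨z, hz, hy⟩
        exact ⟨z, hz.1, by rw [hpx z hz.2]; exact List.mem_cons_of_mem _ hy⟩
    · rintro ⟨z, hz, hy⟩
      exact heB (h.letters z (hss hz) e hy)

lemma Indep.exists_isBaseWords_of_contract (hfin : I.Finite) (hI : M.Indep I)
    (h : ∃ B p, (M ／ I).IsBaseWords B p d) : ∃ B p, M.IsBaseWords B p (d + I.ncard) := by
  induction I, hfin using Set.Finite.induction_on generalizing d with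
  | empty => simpa using h
  | @insert a s ha hs ih =>
    have hs' : M.Indep s := hI.subset (Set.subset_insert a s)
    have hna : (M ／ s).IsNonloop a := by
      rw [← indep_singleton, hs'.contract_indep_iff, Set.singleton_union]
      exact ⟨by simpa using ha, hI⟩
    rw [← Set.union_singleton, ← contract_contract] at h
    rw [Set.ncard_insert_of_notMem ha hs, add_comm _ 1, ← add_assoc]
    exact ih hs' (hna.exists_isBaseWords_of_contractElem h)

theorem exists_isBaseWords_of_forall_isCircuit_ncard_le (M : Matroid α) [M.Finite] (hc : 1 ≤ c)
    (hM : ∀ C, M.IsCircuit C → C.ncard ≤ c) : ∃ B p, M.IsBaseWords B p (c ^ 2) := by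
  induction c using Nat.strong_induction_on generalizing M with
  | _ c ihc =>
  induction hn : M.E.ncard using Nat.strong_induction_on generalizing M with
  | _ n ihn =>
  by_cases hsep : M.IsNonseparable
  · by_cases hlong : ∃ C, M.IsCircuit C ∧ 1 < C.ncard
    · have hbdd : {C | M.IsCircuit C}.Finite :=
        M.ground_finite.finite_subsets.subset fun C hC ↦ hC.subset_ground
      obtain ⟨C₁, hC₁, hlt⟩ := hlong
      obtain ⟨C, hC, hmax⟩ := Set.exists_max_image _ Set.ncard hbdd ⟨C₁, hC₁⟩
      have hC1 : 1 < C.ncard := hlt.trans_le (hmax C₁ hC₁)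
      have hCc : C.ncard ≤ c := hM C hC
      obtain ⟨e, he⟩ := hC.nonempty
      have hcard := Set.ncard_sdiff_singleton_add_one he hC.finite
      have hrec := ihc (c - 1) (by omega) (M ／ (C \ {e})) (by omega) fun D hD ↦ by
        have := hsep.ncard_lt_of_contract hC hmax hC1 he hD
        omega
      obtain ⟨B, p, h⟩ := (hC.sdiff_singleton_indep he).exists_isBaseWords_of_contract
        (hC.finite.subset Set.sdiff_subset) hrec
      refine ⟨B, p, h.mono ?_⟩
      obtain ⟨m, rfl⟩ : ∃ m, c = m + 1 := ⟨c - 1, by omega⟩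
      simp only [Nat.add_sub_cancel]
      nlinarith
    -- A circuit crossing `{x}` would have two elements, so nonseparability leaves at most one
    -- element in the ground set.
    · push Not at hlong
      obtain ⟨B, p, h⟩ : ∃ B p, M.IsBaseWords B p 1 := by
        refine exists_isBaseWords_of_subsingleton fun x hx y hy ↦ ?_
        by_contra hxy
        obtain ⟨C, hC, ⟨a, haC, hax⟩, ⟨b, hbC, hbx⟩⟩ := hsep {x} (by simpa using hx) (by simp)
          (fun h ↦ hxy (by simpa using (h.symm ▸ hy : y ∈ ({x} : Set α)).symm))
        exact hbx (by rw [(Set.ncard_le_one hC.finite).1 (hlong C hC) b hbC a haC]; exact hax)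
      exact ⟨B, p, h.mono (Nat.one_le_pow _ _ hc)⟩
  · simp only [IsNonseparable] at hsep
    push Not at hsep
    obtain ⟨K, hKE, hKne, hKE', hK⟩ := hsep
    have hsplit : ∀ R ⊆ M.E, R.ncard < n → ∃ B p, (M ↾ R).IsBaseWords B p (c ^ 2) := by
      intro R hR hlt
      have : (M ↾ R).Finite := restrict_finite (M.ground_finite.subset hR)
      exact ihn _ hlt (M ↾ R) (fun C hC ↦ hM C ((restrict_isCircuit_iff hR).1 hC).1) rfl
    refine exists_isBaseWords_of_separation hKE (fun C hC ↦ ?_) (hsplit K hKE ?_)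
      (hsplit _ Set.sdiff_subset ?_)
    · by_cases h : (C ∩ K).Nonempty
      · exact .inl (Set.sdiff_eq_empty.1 (hK C hC h))
      · exact .inr fun x hx ↦ ⟨hC.subset_ground hx, fun hxK ↦ h ⟨x, hx, hxK⟩⟩
    · exact hn ▸ Set.ncard_lt_ncard (hKE.ssubset_of_ne hKE') M.ground_finite
    · have := Set.ncard_sdiff_add_ncard_of_subset hKE M.ground_finite
      have := (Set.ncard_pos (M.ground_finite.subset hKE)).2 hKne
      omega

end Matroid

/-! ### Counting elements against prefixes of words -/

section Trie

open Classical in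
/-- The nonempty prefixes of the words `w e` for `e ∈ Y`. -/
noncomputable def trie {α β : Type*} (w : α → List β) (Y : Finset α) : Finset (List β) :=
  Y.biUnion fun e ↦ (w e).inits.toFinset.erase []

variable {α β : Type*} {w : α → List β} {Y Y₁ Y₂ S C : Finset α} {l : List β} {b : β} {d : ℕ}

lemma mem_trie : l ∈ trie w Y ↔ l ≠ [] ∧ ∃ e ∈ Y, l <+: w e := by
  simp [trie]
  tauto

lemma trie_mono (h : Y₁ ⊆ Y₂) : trie w Y₁ ⊆ trie w Y₂ := fun l hl ↦ by
  obtain ⟨h0, e, he, hp⟩ := mem_trie.1 hl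
  exact mem_trie.2 ⟨h0, e, h he, hp⟩

/-- The number of elements of `Y` minus the number of edges of the tree of prefixes of their
words. -/
noncomputable def trieExcess {α β : Type*} (w : α → List β) (Y : Finset α) : ℤ :=
  Y.card - (trie w Y).card

@[simp] lemma trieExcess_empty : trieExcess w ∅ = 0 := by
  simp [trieExcess, trie]

lemma head?_eq_of_prefix {l l' : List β} (hl : l ≠ []) (h : l <+: l') : l'.head? = l.head? := by
  obtain ⟨t, rfl⟩ := h
  cases l with
  | nil => exact absurd rfl hl
  | cons a l => rfl

open Classical in
lemma trieExcess_union (h : ∀ e₁ ∈ Y₁, ∀ e₂ ∈ Y₂, (w e₁).head? ≠ (w e₂).head?) :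
    trieExcess w (Y₁ ∪ Y₂) = trieExcess w Y₁ + trieExcess w Y₂ := by
  have hY : Disjoint Y₁ Y₂ := Finset.disjoint_left.2 fun e he he' ↦ h e he e he' rfl
  have ht : Disjoint (trie w Y₁) (trie w Y₂) := by
    refine Finset.disjoint_left.2 fun l hl hl' ↦ ?_
    obtain ⟨h0, e, he, hp⟩ := mem_trie.1 hl
    obtain ⟨-, e', he', hp'⟩ := mem_trie.1 hl'
    exact h e he e' he' (by rw [head?_eq_of_prefix h0 hp, head?_eq_of_prefix h0 hp'])
  have hu : trie w (Y₁ ∪ Y₂) = trie w Y₁ ∪ trie w Y₂ := by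
    ext l
    simp only [mem_trie, Finset.mem_union]
    grind
  rw [trieExcess, trieExcess, trieExcess, hu, Finset.card_union_of_disjoint hY,
    Finset.card_union_of_disjoint ht]
  push_cast
  ring

open Classical in
lemma trieExcess_filter (w : α → List β) (S : Finset α) (P : Finset (Option β)) :
    trieExcess w {e ∈ S | (w e).head? ∈ P} =
      ∑ h ∈ P, trieExcess w {e ∈ S | (w e).head? = h} := by
  induction P using Finset.induction_on with
  | empty => simp
  | insert a P ha ih =>
    rw [Finset.sum_insert ha, ← ih, ← trieExcess_union]
    · congr 1
      ext e
      simp only [Finset.mem_filter, Finset.mem_union, Finset.mem_insert]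
      tauto
    · intro e₁ h₁ e₂ h₂ h
      rw [Finset.mem_filter] at h₁ h₂
      exact ha (h₁.2 ▸ h ▸ h₂.2)

lemma trieExcess_eq_card_of_nil (h : ∀ e ∈ Y, (w e).head? = none) :
    trieExcess w Y = Y.card := by
  have : trie w Y = ∅ := by
    refine Finset.eq_empty_of_forall_notMem fun l hl ↦ ?_
    obtain ⟨h0, e, he, hp⟩ := mem_trie.1 hl
    rw [List.head?_eq_none_iff.1 (h e he)] at hp
    exact h0 (List.prefix_nil.1 hp)
  simp [trieExcess, this]

-- The common first letter accounts for exactly one prefix, `[b]`, provided `Y` is nonempty.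
open Classical in
lemma trieExcess_tail (h : ∀ e ∈ Y, (w e).head? = some b) (hY : Y.Nonempty) :
    trieExcess (fun e ↦ (w e).tail) Y = trieExcess w Y + 1 := by
  have hw : ∀ e ∈ Y, w e = b :: (w e).tail := by
    intro e he
    exact List.eq_cons_of_mem_head? (h e he)
  have ht : trie w Y = insert [b] ((trie (fun e ↦ (w e).tail) Y).image (List.cons b)) := by
    ext l
    simp only [Finset.mem_insert, Finset.mem_image, mem_trie]
    constructor
    · rintro ⟨h0, e, he, hp⟩
      rw [hw e he] at hp
      obtain rfl | ⟨l', rfl, hl'⟩ := List.prefix_cons_iff.1 hp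
      · exact absurd rfl h0
      · by_cases hl0 : l' = []
        · exact .inl (by rw [hl0])
        · exact .inr ⟨l', ⟨hl0, e, he, hl'⟩, rfl⟩
    · rintro (rfl | ⟨l', ⟨h0, e, he, hp⟩, rfl⟩)
      · obtain ⟨e, he⟩ := hY
        exact ⟨by simp, e, he, by rw [hw e he]; simp⟩
      · exact ⟨by simp, e, he, by rw [hw e he]; exact List.cons_prefix_cons.2 ⟨rfl, hp⟩⟩
  rw [trieExcess, trieExcess, ht, Finset.card_insert_of_notMem,
    Finset.card_image_of_injective _ List.cons_injective]
  · push_cast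
    ring
  · simp [mem_trie]

/-- Excess is additive over the groups with a common first letter. Dropping the groups without
positive excess does not lower the total, so `C` lies in the others. Such a group of excess `y ≥ 1`
inherits the hypotheses, and deleting its first letter raises the excess to `y + 1 ≤ 2 * y`. -/
theorem card_le_two_pow_mul_of_trieExcess {x : ℤ} (hd : ∀ e ∈ S, (w e).length ≤ d)
    (hCS : C ⊆ S) (hx : x ≤ trieExcess w S)
    (hlt : ∀ Y ⊆ S, ¬ C ⊆ Y → trieExcess w Y < x)
    (hle : ∀ Y ⊆ S, trieExcess w Y ≤ x) : (C.card : ℤ) ≤ 2 ^ d * x := by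
  classical
  induction d generalizing w S C x with
  | zero =>
    have h0 := trieExcess_eq_card_of_nil (w := w) (Y := S) fun e he ↦ by
      simpa using hd e he
    have := hle S subset_rfl
    have := Finset.card_le_card hCS
    simp
    omega
  | succ d ih =>
  set y : Option β → ℤ := fun h ↦ trieExcess w {e ∈ S | (w e).head? = h} with hy
  set H := S.image fun e ↦ (w e).head? with hH
  set P := H.filter fun h ↦ 0 < y h with hP
  set SP : Finset α := {e ∈ S | (w e).head? ∈ P} with hSP
  have hSPS : SP ⊆ S := Finset.filter_subset _ _
  have hsumP : trieExcess w SP = ∑ h ∈ P, y h := trieExcess_filter w S P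
  have hxP : x ≤ trieExcess w SP := by
    refine hx.trans ?_
    have hS : S = {e ∈ S | (w e).head? ∈ H} := by
      ext e
      simp only [hH, Finset.mem_filter, Finset.mem_image]
      exact ⟨fun h ↦ ⟨h, e, h, rfl⟩, fun h ↦ h.1⟩
    have hsum : trieExcess w S = ∑ h ∈ H, y h := by
      conv_lhs => rw [hS]
      exact trieExcess_filter w S H
    rw [hsum, hsumP, hP, Finset.sum_filter]
    refine Finset.sum_le_sum fun h _ ↦ ?_
    split_ifs with h0
    · rfl
    · exact not_lt.1 h0
  have hCP : C ⊆ SP := by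
    by_contra h
    exact absurd (hlt SP hSPS h) (not_lt.2 hxP)
  have hcardC : C.card = ∑ h ∈ P, (C.filter fun e ↦ (w e).head? = h).card :=
    Finset.card_eq_sum_card_fiberwise fun e he ↦ (Finset.mem_filter.1 (hCP he)).2
  have hpart : ∀ h ∈ P,
      ((C.filter fun e ↦ (w e).head? = h).card : ℤ) ≤ 2 ^ (d + 1) * y h := by
    intro h hh
    have hpos : 0 < y h := (Finset.mem_filter.1 hh).2
    set Sh : Finset α := {e ∈ S | (w e).head? = h} with hSh
    have hChS : (C.filter fun e ↦ (w e).head? = h) ⊆ Sh := Finset.filter_subset_filter _ hCS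
    obtain rfl | ⟨b, rfl⟩ : h = none ∨ ∃ b, h = some b := by cases h <;> simp
    · have h1 : y none = Sh.card :=
        trieExcess_eq_card_of_nil fun e he ↦ (Finset.mem_filter.1 he).2
      have h2 := Finset.card_le_card hChS
      have h3 : (1 : ℤ) ≤ 2 ^ (d + 1) := one_le_pow₀ (by norm_num)
      nlinarith
    · have hShne : Sh.Nonempty := by
        rw [Finset.nonempty_iff_ne_empty]
        intro h0
        have : y (some b) = trieExcess w Sh := rfl
        rw [h0, trieExcess_empty] at this
        omega
      have htail : ∀ Y ⊆ Sh, Y.Nonempty →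
          trieExcess (fun e ↦ (w e).tail) Y = trieExcess w Y + 1 := fun Y hY hne ↦
        trieExcess_tail (fun e he ↦ (Finset.mem_filter.1 (hY he)).2) hne
      set R : Finset α := {e ∈ S | (w e).head? ∈ P.erase (some b)} with hR
      have hRS : R ⊆ S := Finset.filter_subset _ _
      have hRsum : trieExcess w R + y (some b) = trieExcess w SP := by
        rw [hsumP, hR, trieExcess_filter, Finset.sum_erase_add _ _ hh]
      -- Adding the other positive groups `R` turns a bound on subsets of `S` into one on subsets of
      -- this group.
      have hYR : ∀ Y ⊆ Sh, trieExcess w (Y ∪ R) = trieExcess w Y + trieExcess w R := by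
        refine fun Y hY ↦ trieExcess_union fun e₁ h₁ e₂ h₂ heq ↦ ?_
        have h3 := (Finset.mem_filter.1 (hY h₁)).2
        have h4 := (Finset.mem_filter.1 h₂).2
        rw [← heq, h3] at h4
        simp at h4
      have hYRS : ∀ Y ⊆ Sh, Y ∪ R ⊆ S := fun Y hY ↦
        Finset.union_subset (hY.trans (Finset.filter_subset _ _)) hRS
      have hrec := ih (w := fun e ↦ (w e).tail) (S := Sh)
        (C := C.filter fun e ↦ (w e).head? = some b) (x := y (some b) + 1) ?_ hChS
        (htail Sh subset_rfl hShne).ge ?_ ?_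
      · refine hrec.trans ?_
        rw [pow_succ, mul_assoc]
        exact mul_le_mul_of_nonneg_left (by omega) (by positivity)
      · intro e he
        have := hd e (Finset.mem_filter.1 he).1
        rw [List.length_tail]
        omega
      · intro Y hY hCY
        obtain rfl | hne := Y.eq_empty_or_nonempty
        · rw [trieExcess_empty]
          omega
        have h1 := hlt (Y ∪ R) (hYRS Y hY) fun hC' ↦ hCY fun e he ↦ by
          obtain ⟨heC, heb⟩ := Finset.mem_filter.1 he
          refine (Finset.mem_union.1 (hC' heC)).resolve_right fun heR ↦ ?_
          have := (Finset.mem_filter.1 heR).2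
          simp [heb] at this
        have := hYR Y hY
        have := htail Y hY hne
        omega
      · intro Y hY
        obtain rfl | hne := Y.eq_empty_or_nonempty
        · rw [trieExcess_empty]
          omega
        have h1 := hle (Y ∪ R) (hYRS Y hY)
        have := hYR Y hY
        have := htail Y hY hne
        omega
  calc (C.card : ℤ) = ∑ h ∈ P, ((C.filter fun e ↦ (w e).head? = h).card : ℤ) := by
        rw [hcardC]; push_cast; rfl
    _ ≤ ∑ h ∈ P, 2 ^ (d + 1) * y h := Finset.sum_le_sum hpart
    _ = 2 ^ (d + 1) * trieExcess w SP := by rw [hsumP, Finset.mul_sum]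
    _ ≤ 2 ^ (d + 1) * x := mul_le_mul_of_nonneg_left (hle SP hSPS) (by positivity)

end Trie

/-! ### Depth bounds circuit length -/

namespace FinRootedTree

variable (T : FinRootedTree)

lemma exists_isPath_length_eq_dist (v : T.V) :
    ∃ p : T.graph.Walk T.root v, p.IsPath ∧ p.length = T.graph.dist T.root v :=
  (T.isTree.connected.preconnected T.root v).exists_path_of_dist

/-- The path from the root to `v`. -/
noncomputable def rootPath (v : T.V) : T.graph.Walk T.root v :=
  (T.exists_isPath_length_eq_dist v).choose

lemma rootPath_isPath (v : T.V) : (T.rootPath v).IsPath :=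
  (T.exists_isPath_length_eq_dist v).choose_spec.1

lemma length_rootPath (v : T.V) : (T.rootPath v).length = T.graph.dist T.root v :=
  (T.exists_isPath_length_eq_dist v).choose_spec.2

variable {T} in
lemma eq_rootPath {v : T.V} {p : T.graph.Walk T.root v} (hp : p.IsPath) : p = T.rootPath v :=
  (T.isTree.existsUnique_path T.root v).unique hp (T.rootPath_isPath v)

/-- A vertex farthest from the root has no children, so its distance is one of the lengths defining
the depth. -/
lemma dist_root_le_depth (v : T.V) : T.graph.dist T.root v ≤ T.depth := by
  have := T.finite
  have : Nonempty T.V := ⟨T.root⟩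
  obtain ⟨m, hm⟩ := Finite.exists_max (T.graph.dist T.root)
  refine (hm v).trans (le_csSup ⟨T.graph.dist T.root m, ?_⟩
    ⟨m, fun u hu ↦ ?_, T.rootPath m, T.rootPath_isPath m, T.length_rootPath m⟩)
  · rintro n ⟨u, -, p, hp, rfl⟩
    rw [eq_rootPath hp, length_rootPath]
    exact hm u
  · have := hm u
    rw [hu.2] at this
    omega

/-- A nonempty prefix of a root path is itself the root path of a vertex other than the root. -/
lemma trie_rootPath_subset {α : Type*} (f : α → T.V) (Y : Finset α) [Fintype T.V]
    [DecidableEq T.V] :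
    trie (fun e ↦ (T.rootPath (f e)).edges) Y ⊆
      (Finset.univ.erase T.root).image fun v ↦ (T.rootPath v).edges := by
  intro l hl
  obtain ⟨h0, e, -, hp⟩ := mem_trie.1 hl
  set p := T.rootPath (f e) with hpdef
  have hl' : l = (p.take l.length).edges := by
    rw [SimpleGraph.Walk.edges_take]
    exact List.prefix_iff_eq_take.1 hp
  have hpath := eq_rootPath ((T.rootPath_isPath (f e)).take l.length)
  rw [hpath] at hl'
  refine Finset.mem_image.2 ⟨_, Finset.mem_erase.2 ⟨fun hroot ↦ h0 ?_, Finset.mem_univ _⟩, hl'.symm⟩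
  rw [← List.length_eq_zero_iff, hl', SimpleGraph.Walk.length_edges, length_rootPath, hroot,
    SimpleGraph.dist_self]

lemma card_trie_rootPath_le {α : Type*} (f : α → T.V) (Y : Finset α) :
    ((trie (fun e ↦ (T.rootPath (f e)).edges) Y).card : ℕ∞) ≤ T.graph.edgeSet.encard := by
  classical
  have := T.finite
  have := Fintype.ofFinite T.V
  have h1 := (Finset.card_le_card (T.trie_rootPath_subset f Y)).trans Finset.card_image_le
  rw [Finset.card_erase_of_mem (Finset.mem_univ _), Finset.card_univ, ← Nat.card_eq_fintype_card,
    ← (SimpleGraph.isTree_iff_connected_and_card.1 T.isTree).2, Nat.add_sub_cancel,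
    Nat.card_coe_set_eq] at h1
  rw [← (Set.toFinite T.graph.edgeSet).cast_ncard_eq]
  exact_mod_cast h1

/-- Every covered edge is the last letter of the prefix that ends with it. -/
lemma encard_rootPathsEdges_le {α : Type*} (f : α → T.V) (Y : Finset α) :
    (T.rootPathsEdges (f '' Y)).encard ≤ (trie (fun e ↦ (T.rootPath (f e)).edges) Y).card := by
  classical
  rw [← (Option.some_injective _).encard_image]
  calc _ ≤ Set.encard ((trie (fun e ↦ (T.rootPath (f e)).edges) Y).image List.getLast? :
          Set (Option (Sym2 T.V))) := ?_
    _ ≤ _ := by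
      rw [Set.encard_coe_eq_coe_finsetCard]
      exact_mod_cast Finset.card_image_le
  refine Set.encard_le_encard ?_
  rintro _ ⟨a, ⟨_, ⟨e, he, rfl⟩, p, hp, ha⟩, rfl⟩
  rw [eq_rootPath hp] at ha
  obtain ⟨s, t, hst⟩ := List.append_of_mem ha
  refine Finset.mem_coe.2 (Finset.mem_image.2 ⟨s ++ [a], mem_trie.2 ⟨by simp, e, he, t, ?_⟩, by simp⟩)
  simp [hst]

end FinRootedTree

/-- `C` is the only circuit in `insert x B`: eliminating `x` from two such circuits would leave one
inside `B`. -/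
lemma Matroid.Indep.indep_of_not_isCircuit_subset {α : Type*} {M : Matroid α} {B C Y : Set α}
    {x : α} (hB : M.Indep B) (hC : M.IsCircuit C) (hCB : C ⊆ insert x B) (hYB : Y ⊆ insert x B)
    (hYE : Y ⊆ M.E) (hY : ¬ C ⊆ Y) : M.Indep Y := by
  rw [Matroid.indep_iff_forall_subset_not_isCircuit hYE]
  intro Z hZY hZ
  obtain ⟨U, hUss, hU⟩ := hC.elimination hZ (fun h ↦ hY (h ▸ hZY)) x
  refine hU.not_indep (hB.subset fun y hy ↦ ?_)
  obtain ⟨h | h, hyx⟩ := hUss hy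
  · exact (hCB h).resolve_left hyx
  · exact (hYB (hZY h)).resolve_left hyx

namespace DepthDecomposition

variable {α : Type*} {M : Matroid α}

/-- The depth of a depth-decomposition bounds the length of every circuit. -/
theorem ncard_isCircuit_le [M.Finite] (D : DepthDecomposition M) {C : Set α}
    (hC : M.IsCircuit C) : C.ncard ≤ 2 ^ D.tree.depth := by
  classical
  obtain ⟨x, hx⟩ := hC.nonempty
  obtain ⟨B, hB, hCB⟩ := (hC.sdiff_singleton_indep hx).exists_isBase_superset
  have hxB : x ∉ B := fun h ↦ hC.not_indep (hB.indep.subset fun y hy ↦ by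
    by_cases hyx : y = x
    · exact hyx ▸ h
    · exact hCB ⟨hy, hyx⟩)
  have hCB' : C ⊆ insert x B := fun y hy ↦ by
    by_cases hyx : y = x
    · exact .inl hyx
    · exact .inr (hCB ⟨hy, hyx⟩)
  have hSE : insert x B ⊆ M.E := Set.insert_subset (hC.subset_ground hx) hB.subset_ground
  have hBfin : B.Finite := M.ground_finite.subset hB.subset_ground
  lift B to Finset α using hBfin
  lift C to Finset α using hC.finite
  rw [← Finset.coe_insert] at hCB' hSE
  set w : α → List (Sym2 D.tree.V) := fun e ↦ (D.tree.rootPath (D.f e)).edges with hw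
  have hexc : ∀ Y : Finset α, M.Indep Y → trieExcess w Y ≤ 0 := by
    intro Y hY
    have h1 := D.rank_le Y hY.subset_ground
    rw [hY.eRk_eq_encard, Set.encard_coe_eq_coe_finsetCard] at h1
    have h2 : Y.card ≤ (trie w Y).card := by
      exact_mod_cast h1.trans (D.tree.encard_rootPathsEdges_le D.f Y)
    rw [trieExcess]
    omega
  have hlt : ∀ Y ⊆ insert x B, ¬ C ⊆ Y → trieExcess w Y ≤ 0 := fun Y hYS hCY ↦
    hexc Y (hB.indep.indep_of_not_isCircuit_subset hC (by exact_mod_cast hCB')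
      (by exact_mod_cast hYS) ((Finset.coe_subset.2 hYS).trans hSE) (by exact_mod_cast hCY))
  have key := card_le_two_pow_mul_of_trieExcess (w := w) (S := insert x B) (C := C) (x := 1)
    (d := D.tree.depth) (fun e _ ↦ by
      rw [hw, SimpleGraph.Walk.length_edges, FinRootedTree.length_rootPath]
      exact D.tree.dist_root_le_depth _)
    (by exact_mod_cast hCB') ?_ (fun Y hYS hCY ↦ by have := hlt Y hYS hCY; omega) ?_
  · rw [Set.ncard_coe_finset]
    exact_mod_cast (mul_one (2 ^ D.tree.depth : ℤ)) ▸ key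
  -- There are `|B| + 1` elements, but the tree has only `|B|` edges.
  · have h1 := D.tree.card_trie_rootPath_le D.f (insert x B)
    rw [← D.rank_eq, ← hB.encard_eq_eRank, Set.encard_coe_eq_coe_finsetCard] at h1
    have h2 : (trie w (insert x B)).card ≤ B.card := by exact_mod_cast h1
    rw [trieExcess, Finset.card_insert_of_notMem (by exact_mod_cast hxB)]
    push_cast
    omega
  · intro Y hYS
    have h1 := hexc (Y.erase x) (hB.indep.subset fun y hy ↦ by
      obtain ⟨hyx, hyY⟩ := Finset.mem_erase.1 hy
      exact (Finset.mem_insert.1 (hYS hyY)).resolve_left hyx)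
    have h2 : (trie w (Y.erase x)).card ≤ (trie w Y).card :=
      Finset.card_le_card (trie_mono (Finset.erase_subset _ _))
    have h3 := Finset.pred_card_le_card_erase (s := Y) (a := x)
    rw [trieExcess] at h1 ⊢
    omega

end DepthDecomposition

/-! ### Rooted trees from parent functions -/

section ParentGraph

variable {V : Type} {r : V} {par : V → V} {W : V → List V}

/-- The graph in which every vertex other than `r` is joined to its parent. -/
def parentGraph (r : V) (par : V → V) : SimpleGraph V :=
  SimpleGraph.fromRel fun u v ↦ u ≠ r ∧ par u = v

/-- `W` lists, for every vertex, its ancestors other than the root, ending with the vertex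
itself. -/
structure IsAncestorWords (r : V) (par : V → V) (W : V → List V) : Prop where
  root : W r = []
  append : ∀ v, v ≠ r → W v = W (par v) ++ [v]

namespace IsAncestorWords

lemma length_eq (h : IsAncestorWords r par W) {v : V} (hv : v ≠ r) :
    (W v).length = (W (par v)).length + 1 := by
  simp [h.append v hv]

lemma adj_par (h : IsAncestorWords r par W) {v : V} (hv : v ≠ r) :
    (parentGraph r par).Adj (par v) v := by
  refine (SimpleGraph.fromRel_adj _ _ _).2 ⟨fun he ↦ ?_, .inr ⟨hv, rfl⟩⟩
  have := h.length_eq hv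
  rw [he] at this
  omega

lemma exists_walk (h : IsAncestorWords r par W) (v : V) :
    ∃ p : (parentGraph r par).Walk r v, p.length = (W v).length ∧
      ∀ u ∈ W v, s(par u, u) ∈ p.edges := by
  induction hn : (W v).length generalizing v with
  | zero =>
    obtain rfl : v = r := by
      by_contra hv
      have := h.length_eq hv
      omega
    exact ⟨.nil, rfl, by simp [h.root]⟩
  | succ n ih =>
    have hv : v ≠ r := by
      rintro rfl
      simp [h.root] at hn
    obtain ⟨p, hp, hp'⟩ := ih (par v) (by have := h.length_eq hv; omega)
    refine ⟨p.concat (h.adj_par hv), by simp [hp], fun u hu ↦ ?_⟩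
    rw [h.append v hv, List.mem_append, List.mem_singleton] at hu
    rw [SimpleGraph.Walk.edges_concat, List.concat_eq_append, List.mem_append, List.mem_singleton]
    obtain hu | rfl := hu
    · exact .inl (hp' u hu)
    · exact .inr rfl

/-- Each edge changes the word length by one; this gives the lower bound on distances from the root.
-/
lemma length_le_of_walk (h : IsAncestorWords r par W) {u v : V}
    (p : (parentGraph r par).Walk u v) : (W v).length ≤ (W u).length + p.length := by
  induction p with
  | nil => simp
  | cons hadj p ih =>
    rw [SimpleGraph.Walk.length_cons]
    obtain ⟨-, ⟨h0, rfl⟩ | ⟨h0, rfl⟩⟩ := (SimpleGraph.fromRel_adj _ _ _).1 hadj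
    · have := h.length_eq h0
      omega
    · have := h.length_eq h0
      omega

lemma connected (h : IsAncestorWords r par W) : (parentGraph r par).Connected := by
  have hr : ∀ v, (parentGraph r par).Reachable r v := fun v ↦ ⟨(h.exists_walk v).choose⟩
  have : Nonempty V := ⟨r⟩
  exact ⟨fun u v ↦ (hr u).symm.trans (hr v)⟩

lemma dist_eq (h : IsAncestorWords r par W) (v : V) :
    (parentGraph r par).dist r v = (W v).length := by
  obtain ⟨p, hp, -⟩ := h.exists_walk v
  refine le_antisymm (hp ▸ SimpleGraph.dist_le p) ?_
  obtain ⟨q, hq⟩ := h.connected.exists_walk_length_eq_dist r v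
  simpa [h.root, hq] using h.length_le_of_walk q

lemma injOn_edge (h : IsAncestorWords r par W) : Set.InjOn (fun v ↦ s(par v, v)) {v | v ≠ r} := by
  intro u hu v hv huv
  obtain ⟨-, h1⟩ | ⟨h1, h2⟩ := Sym2.eq_iff.1 huv
  · exact h1
  · have h3 := h.length_eq hu
    have h4 := h.length_eq hv
    rw [h1] at h3
    rw [← h2] at h4
    omega

lemma edgeSet_eq (h : IsAncestorWords r par W) :
    (parentGraph r par).edgeSet = (fun v ↦ s(par v, v)) '' {v | v ≠ r} := by
  ext a
  induction a with
  | _ u v =>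
  constructor
  · intro ha
    obtain ⟨-, ⟨h0, rfl⟩ | ⟨h0, rfl⟩⟩ :=
      (SimpleGraph.fromRel_adj _ _ _).1 ((SimpleGraph.mem_edgeSet _).1 ha)
    · exact ⟨u, h0, Sym2.eq_swap⟩
    · exact ⟨v, h0, rfl⟩
  · rintro ⟨x, hx, hxe⟩
    rw [← hxe]
    exact h.adj_par hx

lemma encard_edgeSet (h : IsAncestorWords r par W) :
    (parentGraph r par).edgeSet.encard = {v | v ≠ r}.encard := by
  rw [h.edgeSet_eq, h.injOn_edge.encard_image]

lemma isTree [Finite V] (h : IsAncestorWords r par W) : (parentGraph r par).IsTree := by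
  refine SimpleGraph.isTree_iff_connected_and_card.2 ⟨h.connected, ?_⟩
  rw [Nat.card_coe_set_eq, h.edgeSet_eq, h.injOn_edge.ncard_image]
  have := Set.ncard_add_ncard_compl {r}
  rw [Set.ncard_singleton] at this
  rw [add_comm]
  exact this

/-- The rooted tree given by a parent function. -/
def tree [Finite V] (h : IsAncestorWords r par W) : FinRootedTree where
  V := V
  finite := inferInstance
  graph := parentGraph r par
  isTree := h.isTree
  root := r

lemma tree_isLeaf [Finite V] (h : IsAncestorWords r par W) {v : V}
    (hv : ∀ u, u ≠ r → par u ≠ v) : h.tree.IsLeaf v := by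
  rintro (u : V) ⟨hadj, hdist⟩
  change (parentGraph r par).dist r u = (parentGraph r par).dist r v + 1 at hdist
  rw [h.dist_eq, h.dist_eq] at hdist
  obtain ⟨-, ⟨h0, rfl⟩ | ⟨h0, h1⟩⟩ := (SimpleGraph.fromRel_adj _ _ _).1 hadj
  · have := h.length_eq h0
    omega
  · exact hv u h0 h1

lemma tree_depth_le [Finite V] (h : IsAncestorWords r par W) {d : ℕ}
    (hd : ∀ v, (W v).length ≤ d) : h.tree.depth ≤ d := by
  refine csSup_le' ?_
  rintro n ⟨v, -, p, hp, rfl⟩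
  rw [FinRootedTree.eq_rootPath hp, FinRootedTree.length_rootPath]
  exact (h.dist_eq v).trans_le (hd v)

lemma mem_rootPathsEdges [Finite V] (h : IsAncestorWords r par W) {S : Set V} {u v : V}
    (hv : v ∈ S) (hu : u ∈ W v) : s(par u, u) ∈ h.tree.rootPathsEdges S := by
  obtain ⟨p, hp, hp'⟩ := h.exists_walk v
  exact ⟨v, hv, p, p.isPath_of_length_eq_dist (hp.trans (h.dist_eq v).symm), hp' u hu⟩

/-- Used to push elements outside the base down to leaves: their root paths only grow, so the rank
condition survives. -/
lemma exists_leaf [Finite V] (h : IsAncestorWords r par W) (u : V) :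
    ∃ v, (∀ c, c ≠ r → par c ≠ v) ∧ W u <+: W v := by
  obtain ⟨v, hv, hmax⟩ := Set.exists_max_image {v | W u <+: W v} (fun v ↦ (W v).length)
    (Set.toFinite _) ⟨u, List.prefix_rfl⟩
  refine ⟨v, ?_, hv⟩
  rintro c hc rfl
  have h1 := hmax c (hv.trans ⟨[c], (h.append c hc).symm⟩)
  have h2 := h.length_eq hc
  omega

end IsAncestorWords

end ParentGraph

/-! ### From words to a depth-decomposition, and the conclusion -/

namespace Matroid

variable {α : Type*} {M : Matroid α} {B : Set α} {p : α → List α} {d : ℕ}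

theorem IsBaseWords.exists_depthDecomposition [M.Finite] (h : M.IsBaseWords B p d) :
    ∃ D : DepthDecomposition M, Set.BijOn D.f B {v | v ≠ D.tree.root} ∧
      (∀ e ∈ M.E \ B, D.tree.IsLeaf (D.f e)) ∧ D.tree.depth ≤ d := by
  classical
  have hBE := h.isBase.subset_ground
  have hBfin : Finite B := M.ground_finite.subset hBE
  -- Tree vertices must live in `Type`, so `B` is copied to `Fin n`, with `none` as the root.
  obtain ⟨n, ⟨ι⟩⟩ := Finite.exists_equiv_fin B
  let toV : α → Option (Fin n) := fun x ↦ if hx : x ∈ B then some (ι ⟨x, hx⟩) else none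
  have htoV : ∀ x (hx : x ∈ B), toV x = some (ι ⟨x, hx⟩) := fun x hx ↦ dif_pos hx
  have htoVne : ∀ x ∈ B, toV x ≠ none := fun x hx ↦ by simp [htoV x hx]
  let W : Option (Fin n) → List (Option (Fin n)) := fun v ↦
    v.elim [] fun i ↦ (p (ι.symm i)).map toV
  have hWB : ∀ b ∈ B, W (toV b) = (p b).map toV := fun b hb ↦ by simp [htoV b hb, W]
  have hpar : ∀ v : Option (Fin n), ∃ u, v ≠ none → W v = W u ++ [v] := by
    rintro (_ | i)
    · exact ⟨none, fun h ↦ absurd rfl h⟩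
    obtain ⟨⟨b, hb⟩, rfl⟩ := ι.surjective i
    rw [← htoV b hb, hWB b hb]
    obtain ⟨q, hq, rfl | ⟨b', hb', rfl⟩⟩ := h.parent b hb
    · exact ⟨none, fun _ ↦ by simp [hq, W]⟩
    · exact ⟨toV b', fun _ ↦ by rw [hWB b' hb', hq]; simp⟩
  choose par hpar using hpar
  have hA : IsAncestorWords none par W := ⟨rfl, hpar⟩
  have hf : ∀ e, ∃ v, (e ∈ B → v = toV e) ∧ (e ∈ M.E \ B → ∀ c, c ≠ none → par c ≠ v) ∧
      (e ∈ M.E → ∀ x ∈ p e, toV x ∈ W v) := by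
    intro e
    by_cases heB : e ∈ B
    · refine ⟨toV e, fun _ ↦ rfl, fun h ↦ absurd heB h.2, fun _ x hx ↦ ?_⟩
      rw [hWB e heB]
      exact List.mem_map_of_mem hx
    by_cases heE : e ∈ M.E
    · obtain ⟨u, hu⟩ : ∃ u, ∀ x ∈ p e, toV x ∈ W u := by
        obtain h0 | ⟨b, hb, h0⟩ := h.vertex e heE
        · exact ⟨none, by simp [h0]⟩
        · refine ⟨toV b, fun x hx ↦ ?_⟩
          rw [hWB b hb, h0]
          exact List.mem_map_of_mem hx
      obtain ⟨v, hv, huv⟩ := hA.exists_leaf u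
      exact ⟨v, fun h ↦ absurd h heB, fun _ ↦ hv, fun _ x hx ↦ huv.subset (hu x hx)⟩
    · exact ⟨none, fun h ↦ absurd h heB, fun h ↦ absurd h.1 heE, fun h ↦ absurd h heE⟩
  choose f hfB hfleaf hfmem using hf
  have htoVinj : Set.InjOn toV B := by
    intro x hx y hy hxy
    rw [htoV x hx, htoV y hy] at hxy
    simpa using hxy
  have hbij : Set.BijOn f B {v | v ≠ none} := by
    refine ⟨fun b hb ↦ hfB b hb ▸ htoVne b hb, fun x hx y hy hxy ↦ htoVinj hx hy ?_, ?_⟩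
    · rw [← hfB x hx, ← hfB y hy, hxy]
    · rintro (_ | i) hv
      · exact absurd rfl hv
      · exact ⟨ι.symm i, (ι.symm i).2, by rw [hfB _ (ι.symm i).2, htoV _ (ι.symm i).2]; simp⟩
  refine ⟨⟨hA.tree, f, ?_, fun X hX ↦ (h.eRk_le X hX).trans ?_⟩, hbij,
    fun e he ↦ hA.tree_isLeaf (hfleaf e he), hA.tree_depth_le ?_⟩
  · change _ = (parentGraph none par).edgeSet.encard
    rw [hA.encard_edgeSet, ← h.isBase.encard_eq_eRank, ← hbij.image_eq, hbij.injOn.encard_image]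
  · have hlet : {x | ∃ e ∈ X, x ∈ p e} ⊆ B := by
      rintro x ⟨e, he, hx⟩
      exact h.letters e (hX he) x hx
    have hinj : Set.InjOn (fun x ↦ s(par (toV x), toV x)) {x | ∃ e ∈ X, x ∈ p e} :=
      fun x hx y hy hxy ↦ htoVinj (hlet hx) (hlet hy)
        (hA.injOn_edge (htoVne x (hlet hx)) (htoVne y (hlet hy)) hxy)
    rw [← hinj.encard_image]
    refine Set.encard_le_encard ?_
    rintro _ ⟨x, ⟨e, he, hx⟩, rfl⟩
    exact hA.mem_rootPathsEdges (Set.mem_image_of_mem f he) (hfmem e (hX he) x hx)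
  · rintro (_ | i)
    · simp [W]
    · simpa [W] using h.length_le _ (hBE (ι.symm i).2)

end Matroid

theorem corollaryc {α : Type*} (M : Matroid α) [M.Finite] :
    ∃ (D : DepthDecomposition M) (B : Set α),
      M.IsBase B ∧
      Set.BijOn D.f B {v | v ≠ D.tree.root} ∧
      (∀ e ∈ M.E \ B, D.tree.IsLeaf (D.f e)) ∧
      D.tree.depth ≤ 4 ^ branchDepth M := by
  have hex : ∀ c, 1 ≤ c → (∀ C, M.IsCircuit C → C.ncard ≤ c) →
      ∃ (D : DepthDecomposition M) (B : Set α), M.IsBase B ∧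
        Set.BijOn D.f B {v | v ≠ D.tree.root} ∧
        (∀ e ∈ M.E \ B, D.tree.IsLeaf (D.f e)) ∧ D.tree.depth ≤ c ^ 2 := by
    intro c hc hM
    obtain ⟨B, p, h⟩ := M.exists_isBaseWords_of_forall_isCircuit_ncard_le hc hM
    obtain ⟨D, hD⟩ := h.exists_depthDecomposition
    exact ⟨D, B, h.isBase, hD⟩
  -- Some decomposition must exist, so that the infimum in `branchDepth` is attained and is not the
  -- default value 0 of an empty set.
  obtain ⟨D₀, -⟩ := hex (M.E.ncard + 1) (by omega) fun C hC ↦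
    (Set.ncard_le_ncard hC.subset_ground M.ground_finite).trans (Nat.le_succ _)
  have hne : {d | ∃ D : DepthDecomposition M, D.tree.depth = d}.Nonempty :=
    ⟨D₀.tree.depth, D₀, rfl⟩
  obtain ⟨D₁, hD₁⟩ : ∃ D : DepthDecomposition M, D.tree.depth = branchDepth M := Nat.sInf_mem hne
  have h4 : 4 ^ branchDepth M = (2 ^ branchDepth M) ^ 2 := by
    rw [← pow_mul, mul_comm, pow_mul]
    norm_num
  rw [h4]
  exact hex _ Nat.one_le_two_pow fun C hC ↦ hD₁ ▸ D₁.ncard_isCircuit_le hC
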